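/- A grid-labelled graph of type $(a,b)$ is a simple graph $G$ on the vertex set $[a]\times[b]$. An edge $\{(i,j),(k,l)\}$ is diagonal if $i\ne k$ and $j\ne l$, and $D(G)$ denotes the grid-labelled graph of type $(a,b)$ whose edges are the diagonal edges of $G$. A graph $G$ with $e\ge 1$ edges is separable if the density matrix $\rho(G)=L(G)/2e$, where $L(G)$ is the combinatorial Laplacian, is a finite convex combination of matrices $\rho_i\otimes\sigma_i$ with $\rho_i$ an $a\times a$ and $\sigma_i$ a $b\times b$ (complex) density matrix. An extension of $G$ to type $(c,d)$, $c\ge a$, $d\ge b$, is the graph on $[c]\times[d]$ with the same edges. Two graphs of the same type are locally isomorphic if one is carried to the other by a permutation of the rows together with a permutation of the columns. Two graphs of arbitrary types are second-order locally isomorphic if they have extensions to a common type that are locally isomorphic (if the first grid is contained in the second, this means that the first graph has an extension locally isomorphic to the second). A rotation of a graph of type $(3,3)$ is its image under an iterate of the quarter turn $(i,j)\mapsto(j,4-i)$ of the grid. Let $B_2$ (criss-cross) and $B_3$ (tally) be the graphs of type $(3,3)$ with edges $$B_2:\ \{(1,1),(2,2)\},\ \{(1,2),(2,1)\};\qquad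 B_3:\ \{(1,1),(2,2)\},\ \{(1,2),(2,3)\},\ \{(2,1),(1,3)\}.$$ Theorem. Let $m,n\ge 2$ and let $G$ be a grid-labelled graph of type $(m,n)$. (1) If $G$ has exactly $2$ diagonal edges, then $G$ is separable if and only if $B_2$ is second-order locally isomorphic to $D(G)$. (2) If $G$ has exactly $3$ diagonal edges, then $G$ is separable if and only if some rotation of $B_3$ (possibly $B_3$ itself) is second-order locally isomorphic to $D(G)$. In particular, if all edges of $G$ are diagonal, then $D(G)=G$ and the criterion is about $G$ itself. -/

import Mathlib

open scoped Kronecker ComplexOrder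

/-- A grid-labelled graph of type `(a, b)`: a simple graph whose vertices are identified, through
the bijective labelling, with the points of the grid `[a] × [b]`. Row and column labels start
at `0`. -/
abbrev GridGraph (a b : ℕ) : Type := SimpleGraph (Fin a × Fin b)

/-- A density matrix: positive semidefinite with unit trace. -/
def IsDensityMatrix {ι : Type*} [Fintype ι] (ρ : Matrix ι ι ℂ) : Prop :=
  ρ.PosSemidef ∧ ρ.trace = 1

/-- Separability of a bipartite matrix: it is a finite convex combination of Kronecker products
of density matrices of the two subsystems. -/
def IsSeparableMatrix {a b : ℕ} (ρ : Matrix (Fin a × Fin b) (Fin a × Fin b) ℂ) : Prop :=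
  ∃ (N : ℕ) (p : Fin N → ℝ) (α : Fin N → Matrix (Fin a) (Fin a) ℂ)
    (β : Fin N → Matrix (Fin b) (Fin b) ℂ),
    (∀ i, 0 ≤ p i) ∧ ∑ i, p i = 1 ∧
    (∀ i, IsDensityMatrix (α i)) ∧ (∀ i, IsDensityMatrix (β i)) ∧
    ρ = ∑ i, (p i : ℂ) • (α i ⊗ₖ β i)

namespace GridGraph

open Classical in
/-- The matrix `L(G) / 2m` of a grid-labelled graph with `m` edges, where `L(G)` is the
combinatorial Laplacian. -/
noncomputable def density {a b : ℕ} (G : GridGraph a b) :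
    Matrix (Fin a × Fin b) (Fin a × Fin b) ℂ :=
  (1 / (2 * (G.edgeSet.ncard : ℂ))) • G.lapMatrix ℂ

/-- `G ∈ 𝒮`: the matrix `L(G) / 2m` is separable. -/
def IsSeparable {a b : ℕ} (G : GridGraph a b) : Prop :=
  IsSeparableMatrix (density G)

/-- The grid-labelled graph formed by the diagonal edges of `G`, those whose endpoints lie in
different rows and in different columns. -/
def diagonalPart {a b : ℕ} (G : GridGraph a b) : GridGraph a b where
  Adj p q := G.Adj p q ∧ p.1 ≠ q.1 ∧ p.2 ≠ q.2
  symm := ⟨fun _ _ h => ⟨h.1.symm, h.2.1.symm, h.2.2.symm⟩⟩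
  loopless := ⟨fun p h => G.loopless.irrefl p h.1⟩

theorem diagonalPart_eq_self {a b : ℕ} {G : GridGraph a b}
    (h : ∀ p q, G.Adj p q → p.1 ≠ q.1 ∧ p.2 ≠ q.2) : diagonalPart G = G := by
  ext p q
  exact ⟨fun hpq => hpq.1, fun hpq => ⟨hpq, h p q hpq⟩⟩

/-- Two grid-labelled graphs of the same type are locally isomorphic if a permutation of the rows
together with a permutation of the columns carries one to the other. -/
def LocallyIsomorphic {a b : ℕ} (G H : GridGraph a b) : Prop :=
  ∃ (π : Equiv.Perm (Fin a)) (σ : Equiv.Perm (Fin b)),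
    ∀ p q : Fin a × Fin b, G.Adj p q ↔ H.Adj (π p.1, σ p.2) (π q.1, σ q.2)

/-- `H` is an extension of `G`: the grid of `G` is enlarged to that of `H`, and the edges are
unchanged, every old vertex keeping its label and every new vertex being isolated. -/
def IsExtension {a b c d : ℕ} (G : GridGraph a b) (H : GridGraph c d) : Prop :=
  ∃ (hac : a ≤ c) (hbd : b ≤ d),
    H = G.map ((Fin.castLEEmb hac).prodMap (Fin.castLEEmb hbd))

/-- Second order local isomorphism between graphs of arbitrary types: they have extensions to a
common grid that are locally isomorphic. When the grid of `G` fits inside the grid of `H`, this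
says that `G` has an extension locally isomorphic to `H`; see
`secondOrderLocallyIsomorphic_iff`. -/
def SecondOrderLocallyIsomorphic {a b c d : ℕ} (G : GridGraph a b) (H : GridGraph c d) : Prop :=
  ∃ (r s : ℕ) (G' H' : GridGraph r s),
    IsExtension G G' ∧ IsExtension H H' ∧ LocallyIsomorphic G' H'

/-- The quarter turn of the grid, `(i, j) ↦ (j, a + 1 - i)` in labels that start at `1`. -/
def rotate {a b : ℕ} (G : GridGraph a b) : GridGraph b a :=
  G.map ((Equiv.prodComm (Fin a) (Fin b)).trans
    ((Equiv.refl (Fin b)).prodCongr Fin.revPerm)).toEmbedding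

/-- The criss-cross `B₂`, of type `(3, 3)`. -/
def crissCross : GridGraph 3 3 :=
  SimpleGraph.fromEdgeSet {s((0, 0), (1, 1)), s((0, 1), (1, 0))}

/-- The tally `B₃`, of type `(3, 3)`. -/
def tally : GridGraph 3 3 :=
  SimpleGraph.fromEdgeSet {s((0, 0), (1, 1)), s((0, 1), (1, 2)), s((1, 0), (0, 2))}

/-- A permutation of a larger index set restricted to finitely many small indices can be realised
on the smaller index set. -/
theorem exists_perm_of_castLE {c r : ℕ} (hcr : c ≤ r) (π : Equiv.Perm (Fin r))
    (S : Fin c → Prop) (hS : ∀ i, S i → ∃ j, π (Fin.castLE hcr i) = Fin.castLE hcr j) :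
    ∃ τ : Equiv.Perm (Fin c), ∀ i, S i → π (Fin.castLE hcr i) = Fin.castLE hcr (τ i) := by
  classical
  choose f hf using hS
  let g : {i // S i} → Fin c := fun i => f i.1 i.2
  have hg : Function.Injective g := by
    intro i j hij
    have h : π (Fin.castLE hcr i.1) = π (Fin.castLE hcr j.1) := by
      rw [hf i.1 i.2, hf j.1 j.2]
      exact congrArg _ hij
    exact Subtype.ext (Fin.castLE_injective hcr (π.injective h))
  let e : {i // S i} ≃ {j // j ∈ Set.range g} := Equiv.ofInjective g hg
  refine ⟨e.extendSubtype, fun i hi => ?_⟩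
  rw [Equiv.extendSubtype_apply_of_mem e i hi, hf i hi]
  rfl

/-- Adjacency in an extension, at the old vertices. -/
theorem extension_adj {a b c d : ℕ} (hac : a ≤ c) (hbd : b ≤ d) (G : GridGraph a b)
    (p q : Fin a × Fin b) :
    (G.map ((Fin.castLEEmb hac).prodMap (Fin.castLEEmb hbd))).Adj
      (Fin.castLE hac p.1, Fin.castLE hbd p.2) (Fin.castLE hac q.1, Fin.castLE hbd q.2) ↔
      G.Adj p q :=
  SimpleGraph.map_adj_apply (f := (Fin.castLEEmb hac).prodMap (Fin.castLEEmb hbd)) (a := p) (b := q)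

/-- Adjacent vertices of an extension are old vertices. -/
theorem exists_of_extension_adj {a b c d : ℕ} (hac : a ≤ c) (hbd : b ≤ d) (G : GridGraph a b)
    {u v : Fin c × Fin d}
    (h : (G.map ((Fin.castLEEmb hac).prodMap (Fin.castLEEmb hbd))).Adj u v) :
    ∃ p : Fin a × Fin b, u = (Fin.castLE hac p.1, Fin.castLE hbd p.2) := by
  obtain ⟨p, q, -, rfl, -⟩ := (SimpleGraph.map_adj _ _ _ _).1 h
  exact ⟨p, rfl⟩

theorem map_castLE_castLE {a b c d r s : ℕ} (hac : a ≤ c) (hbd : b ≤ d) (hcr : c ≤ r) (hds : d ≤ s)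
    (G : GridGraph a b) :
    G.map ((Fin.castLEEmb (hac.trans hcr)).prodMap (Fin.castLEEmb (hbd.trans hds))) =
      (G.map ((Fin.castLEEmb hac).prodMap (Fin.castLEEmb hbd))).map
        ((Fin.castLEEmb hcr).prodMap (Fin.castLEEmb hds)) := by
  rw [SimpleGraph.map_map]
  rfl

/-- For nested grids, second order local isomorphism means that the smaller graph has an extension
locally isomorphic to the larger one. -/
theorem secondOrderLocallyIsomorphic_iff {a b c d : ℕ} (hac : a ≤ c) (hbd : b ≤ d)
    (G : GridGraph a b) (H : GridGraph c d) :
    SecondOrderLocallyIsomorphic G H ↔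
      ∃ G' : GridGraph c d, IsExtension G G' ∧ LocallyIsomorphic G' H := by
  constructor
  · rintro ⟨r, s, G', H', ⟨har, hbs, rfl⟩, ⟨hcr, hds, rfl⟩, π, σ, h⟩
    refine ⟨_, ⟨hac, hbd, rfl⟩, ?_⟩
    rw [map_castLE_castLE hac hbd hcr hds G] at h
    generalize G.map ((Fin.castLEEmb hac).prodMap (Fin.castLEEmb hbd)) = K at h
    have key : ∀ p q : Fin c × Fin d, K.Adj p q → ∃ t : Fin c × Fin d,
        π (Fin.castLE hcr p.1) = Fin.castLE hcr t.1 ∧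
        σ (Fin.castLE hds p.2) = Fin.castLE hds t.2 := by
      intro p q hpq
      obtain ⟨t, ht⟩ := exists_of_extension_adj hcr hds H
        ((h _ _).1 ((extension_adj hcr hds K p q).2 hpq))
      exact ⟨t, congrArg Prod.fst ht, congrArg Prod.snd ht⟩
    have keyH : ∀ p q : Fin c × Fin d, H.Adj p q → ∃ u v : Fin c × Fin d, K.Adj u v ∧
        π (Fin.castLE hcr u.1) = Fin.castLE hcr p.1 ∧
        σ (Fin.castLE hds u.2) = Fin.castLE hds p.2 ∧
        π (Fin.castLE hcr v.1) = Fin.castLE hcr q.1 ∧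
        σ (Fin.castLE hds v.2) = Fin.castLE hds q.2 := by
      intro p q hpq
      have h1 := (h (π.symm (Fin.castLE hcr p.1), σ.symm (Fin.castLE hds p.2))
        (π.symm (Fin.castLE hcr q.1), σ.symm (Fin.castLE hds q.2))).2
        (by simpa using (extension_adj hcr hds H p q).2 hpq)
      obtain ⟨u, hu⟩ := exists_of_extension_adj hcr hds K h1
      obtain ⟨v, hv⟩ := exists_of_extension_adj hcr hds K h1.symm
      rw [hu, hv, extension_adj] at h1
      simp only [Prod.mk.injEq, Equiv.symm_apply_eq] at hu hv
      exact ⟨u, v, h1, hu.1.symm, hu.2.symm, hv.1.symm, hv.2.symm⟩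
    obtain ⟨τ, hτ⟩ := exists_perm_of_castLE hcr π (fun i => ∃ p q, K.Adj p q ∧ p.1 = i)
      (by rintro i ⟨p, q, hpq, rfl⟩
          obtain ⟨t, ht, -⟩ := key p q hpq
          exact ⟨t.1, ht⟩)
    obtain ⟨ω, hω⟩ := exists_perm_of_castLE hds σ (fun i => ∃ p q, K.Adj p q ∧ p.2 = i)
      (by rintro i ⟨p, q, hpq, rfl⟩
          obtain ⟨t, -, ht⟩ := key p q hpq
          exact ⟨t.2, ht⟩)
    have fwd : ∀ p q, K.Adj p q → H.Adj (τ p.1, ω p.2) (τ q.1, ω q.2) := by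
      intro p q hpq
      have h1 := (h _ _).1 ((extension_adj hcr hds K p q).2 hpq)
      simp only [hτ p.1 ⟨p, q, hpq, rfl⟩, hτ q.1 ⟨q, p, hpq.symm, rfl⟩,
        hω p.2 ⟨p, q, hpq, rfl⟩, hω q.2 ⟨q, p, hpq.symm, rfl⟩] at h1
      exact (extension_adj hcr hds H (τ p.1, ω p.2) (τ q.1, ω q.2)).1 h1
    refine ⟨τ, ω, fun p q => ⟨fwd p q, fun hpq => ?_⟩⟩
    obtain ⟨u, v, huv, h1, h2, h3, h4⟩ := keyH _ _ hpq
    rw [hτ u.1 ⟨u, v, huv, rfl⟩] at h1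
    rw [hω u.2 ⟨u, v, huv, rfl⟩] at h2
    rw [hτ v.1 ⟨v, u, huv.symm, rfl⟩] at h3
    rw [hω v.2 ⟨v, u, huv.symm, rfl⟩] at h4
    have hu : u = p := Prod.ext (τ.injective (Fin.castLE_injective hcr h1))
      (ω.injective (Fin.castLE_injective hds h2))
    have hv : v = q := Prod.ext (τ.injective (Fin.castLE_injective hcr h3))
      (ω.injective (Fin.castLE_injective hds h4))
    rwa [hu, hv] at huv
  · rintro ⟨G', hG, hL⟩
    refine ⟨c, d, G', H, hG, ⟨le_rfl, le_rfl, ?_⟩, hL⟩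
    exact (SimpleGraph.map_id (G := H)).symm

end GridGraph

/-! Necessity is the positive partial transpose test, applied to a single vector. The all-ones
vector lies in the kernel of `L(G)`. Partial transposition only permutes matrix entries, so the
quadratic form of the partial transpose of `ρ(G)` vanishes at this vector. When `G` is separable
that partial transpose is positive semidefinite, so the vector lies in its kernel as well.

Call `{(i, l), (k, j)}` the antidiagonal of the edge `{(i, j), (k, l)}`. Read row by row, the kernel
equation says that each vertex lies on as many edges as antidiagonals. Edges inside a row or a
column cancel, which leaves a condition on `diagonalPart G`. Equality of the supports
(`IsSeparable.exists_adj_iff`) already forces two diagonal edges to form a criss-cross, and three to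
form a tally or its transpose.

For sufficiency, `2 L(G)` is the sum of `v vᴴ`, `v = e_p - e_q`, over ordered adjacent pairs. For an
edge inside a row or a column, `v` is a product vector. For a criss-cross or a tally it is not, but
the discrete Fourier transforms (of order 2 or 3) of the edge vectors are product vectors. By
Parseval they have the same sum of `v vᴴ` up to a scalar.

Finally, second-order local isomorphism amounts to injections of the rows and of the columns that
meet edges. These preserve the shapes, and a quarter turn exchanges the two kinds of tally. -/

/-! ### Necessity: the degree condition from partial transposition. -/

open Matrix in
/-- The sum of all entries in a row of the partial transpose of a separable matrix vanishes when the
sum of all entries of the matrix does. -/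
theorem IsSeparableMatrix.sum_partialTranspose_eq_zero {a b : ℕ}
    {ρ : Matrix (Fin a × Fin b) (Fin a × Fin b) ℂ} (h : IsSeparableMatrix ρ)
    (h0 : ∑ p, ∑ q, ρ p q = 0) (i : Fin a) (j : Fin b) :
    ∑ q : Fin a × Fin b, ρ (i, q.2) (q.1, j) = 0 := by
  obtain ⟨N, p, α, β, hp, -, hα, hβ, rfl⟩ := h
  set τ : Matrix (Fin a × Fin b) (Fin a × Fin b) ℂ := ∑ t, (p t : ℂ) • (α t ⊗ₖ (β t)ᵀ) with hτ
  have hpsd : τ.PosSemidef := by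
    refine Matrix.posSemidef_sum _ fun t _ => ?_
    exact ((hα t).1.kronecker (hβ t).1.transpose).smul (by exact_mod_cast hp t)
  have hentry : ∀ i j k l, τ (i, j) (k, l) =
      (∑ t, (p t : ℂ) • (α t ⊗ₖ β t)) (i, l) (k, j) := by
    intro i j k l
    simp [hτ, Matrix.sum_apply]
  -- The total sum of entries is unchanged by permuting them, so it is still zero for `τ`.
  have hsum : star (fun _ => (1 : ℂ)) ⬝ᵥ τ *ᵥ (fun _ => 1) = 0 := by
    simp only [dotProduct, mulVec, Pi.star_apply, star_one, one_mul, mul_one]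
    rw [← h0]
    simp only [Fintype.sum_prod_type, hentry]
    refine Finset.sum_congr rfl fun x _ => ?_
    rw [Finset.sum_comm, Finset.sum_comm (s := Finset.univ (α := Fin b))]
    exact Finset.sum_congr rfl fun k _ => Finset.sum_comm
  have := congrFun ((hpsd.dotProduct_mulVec_zero_iff _).1 hsum) (i, j)
  simp only [mulVec, dotProduct, mul_one, Pi.zero_apply] at this
  rw [← this]
  exact Finset.sum_congr rfl fun q _ => (hentry i j q.1 q.2).symm

namespace GridGraph

open Classical in
theorem IsSeparable.sum_adj_eq {a b : ℕ} {G : GridGraph a b} (h : IsSeparable G)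
    (he : G.edgeSet.ncard ≠ 0) (i : Fin a) (j : Fin b) :
    ∑ q : Fin a × Fin b, (if G.Adj (i, j) q then 1 else 0 : ℕ) =
      ∑ q : Fin a × Fin b, if G.Adj (i, q.2) (q.1, j) then 1 else 0 := by
  have hc : (1 / (2 * (G.edgeSet.ncard : ℂ))) ≠ 0 := by simpa using he
  have h1 := IsSeparableMatrix.sum_partialTranspose_eq_zero h (by
    have := G.lapMatrix_mulVec_const_eq_zero (R := ℂ)
    have h2 : ∀ p, ∑ q, G.lapMatrix ℂ p q = 0 := fun p => by
      simpa [Matrix.mulVec, dotProduct] using congrFun this p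
    simp [density, ← Finset.mul_sum, h2]) i j
  simp only [density, Matrix.smul_apply, smul_eq_mul, ← Finset.mul_sum, mul_eq_zero, hc,
    false_or] at h1
  -- Among the transposed positions, the diagonal of the Laplacian is met only at `q = (i, j)`.
  have h3 : ∀ q : Fin a × Fin b, G.lapMatrix ℂ (i, q.2) (q.1, j) =
      (if q = (i, j) then (G.degree (i, j) : ℂ) else 0) -
        if G.Adj (i, q.2) (q.1, j) then 1 else 0 := by
    rintro ⟨k, l⟩
    simp only [SimpleGraph.lapMatrix, SimpleGraph.degMatrix, Matrix.sub_apply,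
      Matrix.diagonal_apply, SimpleGraph.adjMatrix_apply, Prod.mk.injEq]
    congr 1
    simp only [eq_comm (a := k), and_comm (a := i = k)]
    refine ite_congr rfl (fun h => ?_) fun _ => rfl
    rw [h.1]
  simp only [h3, Finset.sum_sub_distrib, Finset.sum_ite_eq', Finset.mem_univ, if_true,
    G.degree_eq_sum_if_adj, sub_eq_zero] at h1
  exact_mod_cast h1

-- Partial transposition fixes an edge inside a row or a column, up to reversal. Such edges
-- contribute equally to both counts and cancel.
open Classical in
theorem IsSeparable.sum_diagonalPart_adj_eq {a b : ℕ} {G : GridGraph a b} (h : IsSeparable G)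
    (he : G.edgeSet.ncard ≠ 0) (i : Fin a) (j : Fin b) :
    ∑ q : Fin a × Fin b, (if (diagonalPart G).Adj (i, j) q then 1 else 0 : ℕ) =
      ∑ q : Fin a × Fin b, if (diagonalPart G).Adj (i, q.2) (q.1, j) then 1 else 0 := by
  have h1 := h.sum_adj_eq he i j
  have h2 : ∑ q : Fin a × Fin b,
        (if G.Adj (i, j) q ∧ ¬ (diagonalPart G).Adj (i, j) q then 1 else 0 : ℕ) =
      ∑ q : Fin a × Fin b,
        if G.Adj (i, q.2) (q.1, j) ∧ ¬ (diagonalPart G).Adj (i, q.2) (q.1, j) then 1 else 0 := by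
    refine Finset.sum_congr rfl fun q _ => if_congr ?_ rfl rfl
    obtain ⟨k, l⟩ := q
    simp only [diagonalPart]
    by_cases hk : i = k
    · subst hk
      simp [G.adj_comm]
    · by_cases hl : j = l
      · subst hl; simp
      · have : l ≠ j := fun e => hl e.symm
        simp [hk, hl, this]
  have split : ∀ A B : Prop, (B → A) →
      (if A then 1 else 0 : ℕ) = (if B then 1 else 0) + if A ∧ ¬ B then 1 else 0 := by
    intro A B hBA
    by_cases hA : A <;> by_cases hB : B <;> simp_all
  have h3 := Finset.sum_congr (rfl : Finset.univ = Finset.univ) fun q _ =>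
    split (G.Adj (i, j) q) ((diagonalPart G).Adj (i, j) q) And.left
  have h4 := Finset.sum_congr (rfl : Finset.univ = Finset.univ) fun (q : Fin a × Fin b) _ =>
    split (G.Adj (i, q.2) (q.1, j)) ((diagonalPart G).Adj (i, q.2) (q.1, j)) And.left
  rw [Finset.sum_add_distrib] at h3 h4
  omega

/-- The vertices met by the diagonal edges of a separable graph are those met by the
antidiagonals of the rectangles these edges span. -/
theorem IsSeparable.exists_adj_iff {a b : ℕ} {G : GridGraph a b} (h : IsSeparable G)
    (he : G.edgeSet.ncard ≠ 0) (i : Fin a) (j : Fin b) :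
    (∃ q : Fin a × Fin b, (diagonalPart G).Adj (i, j) q) ↔
      ∃ q : Fin a × Fin b, (diagonalPart G).Adj (i, q.2) (q.1, j) := by
  classical
  have h1 := h.sum_diagonalPart_adj_eq he i j
  have h2 : (∑ q : Fin a × Fin b, (if (diagonalPart G).Adj (i, j) q then 1 else 0 : ℕ) = 0) ↔
      (∑ q : Fin a × Fin b,
        if (diagonalPart G).Adj (i, q.2) (q.1, j) then 1 else 0 : ℕ) = 0 := by rw [h1]
  simpa [Finset.sum_eq_zero_iff, not_iff_not] using not_congr h2

/-! ### Combinatorics: two or three diagonal edges satisfying the vertex condition. -/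

/-- The shape of the criss-cross, anywhere in a grid. -/
def IsCrissCross {a b : ℕ} (G : GridGraph a b) : Prop :=
  ∃ (i k : Fin a) (j l : Fin b), i ≠ k ∧ j ≠ l ∧
    G.edgeSet = {s((i, j), (k, l)), s((i, l), (k, j))}

/-- The shape of the tally, anywhere in a grid. -/
def IsRowTally {a b : ℕ} (G : GridGraph a b) : Prop :=
  ∃ (i k : Fin a) (j₁ j₂ j₃ : Fin b), i ≠ k ∧ j₁ ≠ j₂ ∧ j₁ ≠ j₃ ∧ j₂ ≠ j₃ ∧
    G.edgeSet = {s((i, j₁), (k, j₂)), s((i, j₂), (k, j₃)), s((i, j₃), (k, j₁))}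

/-- The shape of the transposed tally, anywhere in a grid. -/
def IsColTally {a b : ℕ} (G : GridGraph a b) : Prop :=
  ∃ (i₁ i₂ i₃ : Fin a) (j l : Fin b), i₁ ≠ i₂ ∧ i₁ ≠ i₃ ∧ i₂ ≠ i₃ ∧ j ≠ l ∧
    G.edgeSet = {s((i₁, j), (i₂, l)), s((i₂, j), (i₃, l)), s((i₃, j), (i₁, l))}

theorem diagonalPart_edgeSet_ncard_ne_zero {a b : ℕ} {G : GridGraph a b}
    (h : (diagonalPart G).edgeSet.ncard ≠ 0) : G.edgeSet.ncard ≠ 0 := by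
  intro h0
  have h1 : (diagonalPart G).edgeSet.ncard ≤ G.edgeSet.ncard :=
    Set.ncard_le_ncard (SimpleGraph.edgeSet_mono fun _ _ h => h.1) (Set.toFinite _)
  omega

/-- A diagonal edge has no endpoint on its own antidiagonal. So both endpoints of the first edge lie
on the antidiagonal of the second, and the two edges are antidiagonals of each other. -/
theorem IsSeparable.isCrissCross {a b : ℕ} {G : GridGraph a b} (h : IsSeparable G)
    (hD : (diagonalPart G).edgeSet.ncard = 2) : IsCrissCross (diagonalPart G) := by
  have key := h.exists_adj_iff (diagonalPart_edgeSet_ncard_ne_zero (by omega))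
  have hdiag : ∀ p q, (diagonalPart G).Adj p q → p.1 ≠ q.1 ∧ p.2 ≠ q.2 := fun _ _ h => h.2
  unfold IsCrissCross
  generalize diagonalPart G = D at *
  obtain ⟨e₁, e₂, hne, hE⟩ := Set.ncard_eq_two.1 hD
  induction e₁ with | _ p₁ q₁
  induction e₂ with | _ p₂ q₂
  have hadj : ∀ p q, D.Adj p q ↔ s(p, q) = s(p₁, q₁) ∨ s(p, q) = s(p₂, q₂) := by
    intro p q
    rw [← SimpleGraph.mem_edgeSet, hE]; rfl
  obtain ⟨a₁, b₁⟩ := p₁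
  obtain ⟨c₁, d₁⟩ := q₁
  obtain ⟨a₂, b₂⟩ := p₂
  obtain ⟨c₂, d₂⟩ := q₂
  have h1 := hdiag (a₁, b₁) (c₁, d₁) ((hadj _ _).2 (by simp))
  have h2 := hdiag (a₂, b₂) (c₂, d₂) ((hadj _ _).2 (by simp))
  refine ⟨a₁, c₁, b₁, d₁, h1.1, h1.2, ?_⟩
  rw [hE]
  simp only [hadj, Sym2.eq_iff, Prod.exists, Prod.mk.injEq] at key
  have k1 := (key a₁ b₁).1 ⟨c₁, d₁, by simp⟩
  have k2 := (key c₁ d₁).1 ⟨a₁, b₁, by simp⟩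
  have : s((a₂, b₂), (c₂, d₂)) = s((a₁, d₁), (c₁, b₁)) := by
    simp only [Sym2.eq_iff, Prod.mk.injEq]
    grind
  rw [this]

/-- The configuration is normalised so that the antidiagonal of the second edge passes through the
endpoint `(i, j)` of the first. The vertex condition then forces these two edges to share both rows
(row tally) or both columns (column tally), and determines the third edge. -/
theorem isTally_of_corner {a b : ℕ} {D : GridGraph a b} (i k y c₃ a₃ : Fin a)
    (j l x b₃ d₃ : Fin b)
    (hE : D.edgeSet = {s((i, j), (k, l)), s((i, x), (y, j)), s((a₃, b₃), (c₃, d₃))})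
    (hdiag : ∀ p q, D.Adj p q → p.1 ≠ q.1 ∧ p.2 ≠ q.2)
    (key : ∀ i j, (∃ q : Fin a × Fin b, D.Adj (i, j) q) ↔
      ∃ q : Fin a × Fin b, D.Adj (i, q.2) (q.1, j))
    (hne12 : s((i, j), (k, l)) ≠ s((i, x), (y, j)))
    (hne13 : s((i, j), (k, l)) ≠ s((a₃, b₃), (c₃, d₃)))
    (hne23 : s((i, x), (y, j)) ≠ s((a₃, b₃), (c₃, d₃))) :
    IsRowTally D ∨ IsColTally D := by
  have hadj : ∀ p q, D.Adj p q ↔ s(p, q) = s((i, j), (k, l)) ∨ s(p, q) = s((i, x), (y, j)) ∨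
      s(p, q) = s((a₃, b₃), (c₃, d₃)) := by
    intro p q
    rw [← SimpleGraph.mem_edgeSet, hE]; rfl
  have h1 := hdiag (i, j) (k, l) ((hadj _ _).2 (by simp))
  have h2 := hdiag (i, x) (y, j) ((hadj _ _).2 (by simp))
  have h3 := hdiag (a₃, b₃) (c₃, d₃) ((hadj _ _).2 (by simp))
  simp only [hadj, Sym2.eq_iff, Prod.exists, Prod.mk.injEq] at key
  have k1 := (key k l).1 ⟨i, j, by simp⟩
  have k2 := (key i x).1 ⟨y, j, by simp⟩
  have k3 := (key y j).1 ⟨i, x, by simp⟩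
  have k4 := (key a₃ b₃).1 ⟨c₃, d₃, by simp⟩
  have k5 := (key c₃ d₃).1 ⟨a₃, b₃, by simp⟩
  -- Here the condition is used in the other direction: the antidiagonal of the first edge must be
  -- covered by edges.
  have k6 := (key i l).2 ⟨k, j, by simp⟩
  have k7 := (key k j).2 ⟨i, l, by simp⟩
  clear key hadj hdiag
  simp only [ne_eq, Sym2.eq_iff, Prod.mk.injEq] at hne12 hne13 hne23 h1 h2 h3
  have : (y = k ∧ x ≠ l ∧ (a₃ = i ∧ b₃ = l ∧ c₃ = k ∧ d₃ = x ∨ c₃ = i ∧ d₃ = l ∧ a₃ = k ∧ b₃ = x)) ∨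
    (x = l ∧ y ≠ k ∧ (a₃ = k ∧ b₃ = j ∧ c₃ = y ∧ d₃ = l ∨ c₃ = k ∧ d₃ = j ∧ a₃ = y ∧ b₃ = l)) := by
    clear hE
    simp only [exists_and_left, exists_and_right, exists_or, exists_eq, true_and, and_true]
      at k1 k2 k3 k4 k5 k6 k7
    grind (splits := 40)
  rcases this with ⟨rfl, hx, h⟩ | ⟨rfl, hy, h⟩
  · refine Or.inl ⟨i, y, j, l, x, h1.1, h1.2, fun e => h2.2 e.symm, fun e => hx e.symm, ?_⟩
    rw [hE, Set.pair_comm s((i, x), (y, j))]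
    rcases h with ⟨rfl, rfl, rfl, rfl⟩ | ⟨rfl, rfl, rfl, rfl⟩
    · rfl
    · rw [Sym2.eq_swap (a := (a₃, b₃))]
  · refine Or.inr ⟨i, k, y, j, x, h1.1, h2.1, fun e => hy e.symm, h1.2, ?_⟩
    rw [hE, Set.pair_comm s((i, x), (y, j)), Sym2.eq_swap (a := (i, x))]
    rcases h with ⟨rfl, rfl, rfl, rfl⟩ | ⟨rfl, rfl, rfl, rfl⟩
    · rfl
    · rw [Sym2.eq_swap (a := (a₃, b₃))]

theorem IsSeparable.isTally {a b : ℕ} {G : GridGraph a b} (h : IsSeparable G)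
    (hD : (diagonalPart G).edgeSet.ncard = 3) :
    IsRowTally (diagonalPart G) ∨ IsColTally (diagonalPart G) := by
  have key := h.exists_adj_iff (diagonalPart_edgeSet_ncard_ne_zero (by omega))
  have hdiag : ∀ p q, (diagonalPart G).Adj p q → p.1 ≠ q.1 ∧ p.2 ≠ q.2 := fun _ _ h => h.2
  generalize diagonalPart G = D at *
  obtain ⟨e₁, e₂, e₃, hne12, hne13, hne23, hE⟩ := Set.ncard_eq_three.1 hD
  induction e₁ with | _ p₁ q₁
  induction e₂ with | _ p₂ q₂
  induction e₃ with | _ p₃ q₃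
  have hadj : ∀ p q, D.Adj p q ↔ s(p, q) = s(p₁, q₁) ∨ s(p, q) = s(p₂, q₂) ∨
      s(p, q) = s(p₃, q₃) := by
    intro p q
    rw [← SimpleGraph.mem_edgeSet, hE]; rfl
  obtain ⟨a₁, b₁⟩ := p₁
  obtain ⟨c₁, d₁⟩ := q₁
  obtain ⟨a₂, b₂⟩ := p₂
  obtain ⟨c₂, d₂⟩ := q₂
  obtain ⟨a₃, b₃⟩ := p₃
  obtain ⟨c₃, d₃⟩ := q₃
  have h1 := hdiag (a₁, b₁) (c₁, d₁) ((hadj _ _).2 (by simp))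
  obtain ⟨q, hq⟩ := (key a₁ b₁).1 ⟨(c₁, d₁), (hadj _ _).2 (by simp)⟩
  -- The second and third edges play symmetric roles; this is the edge set with them exchanged.
  have hE' := hE.trans (congrArg _ (Set.pair_comm _ _))
  rcases (hadj _ _).1 hq with hq | hq | hq
  -- An edge covering an endpoint by its own antidiagonal would not be diagonal.
  · simp only [Sym2.eq_iff, Prod.mk.injEq] at hq
    grind
  · rw [← hq] at hE hne12 hne23
    exact isTally_of_corner _ _ _ _ _ _ _ _ _ _ hE hdiag key hne12 hne13 hne23
  · rw [← hq] at hE' hne13 hne23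
    exact isTally_of_corner _ _ _ _ _ _ _ _ _ _ hE' hdiag key hne13 hne12 hne23.symm

end GridGraph

/-! ### The cone of unnormalised separable matrices, and its members needed here. -/

/-- The additive monoid generated by the Kronecker products of positive semidefinite matrices. -/
def separableCone (a b : ℕ) : AddSubmonoid (Matrix (Fin a × Fin b) (Fin a × Fin b) ℂ) :=
  AddSubmonoid.closure {M | ∃ α β, α.PosSemidef ∧ β.PosSemidef ∧ M = α ⊗ₖ β}

theorem smul_mem_separableCone {a b : ℕ} {M : Matrix (Fin a × Fin b) (Fin a × Fin b) ℂ}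
    (hM : M ∈ separableCone a b) {r : ℂ} (hr : 0 ≤ r) : r • M ∈ separableCone a b := by
  induction hM using AddSubmonoid.closure_induction with
  | mem x hx =>
    obtain ⟨α, β, hα, hβ, rfl⟩ := hx
    exact AddSubmonoid.subset_closure ⟨r • α, β, hα.smul hr, hβ, by rw [Matrix.smul_kronecker]⟩
  | zero => rw [smul_zero]; exact zero_mem _
  | add x y _ _ hx hy => rw [smul_add]; exact add_mem hx hy

/-- A nonzero product has nonzero positive semidefinite factors, whose traces are positive and can
be divided out. -/
theorem kronecker_exists_density {a b : ℕ} {α : Matrix (Fin a) (Fin a) ℂ}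
    {β : Matrix (Fin b) (Fin b) ℂ} (hα : α.PosSemidef) (hβ : β.PosSemidef) (h0 : α ⊗ₖ β ≠ 0) :
    ∃ (r : ℝ) (α' : Matrix (Fin a) (Fin a) ℂ) (β' : Matrix (Fin b) (Fin b) ℂ), 0 ≤ r ∧
      IsDensityMatrix α' ∧ IsDensityMatrix β' ∧ α ⊗ₖ β = (r : ℂ) • (α' ⊗ₖ β') := by
  have normalize : ∀ {c : ℕ} {γ : Matrix (Fin c) (Fin c) ℂ}, γ.PosSemidef → γ ≠ 0 →
      ∃ r : ℝ, 0 ≤ r ∧ ∃ γ', IsDensityMatrix γ' ∧ γ = (r : ℂ) • γ' := by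
    intro c γ hγ hne
    have ht : γ.trace ≠ 0 := fun h => hne (hγ.trace_eq_zero_iff.1 h)
    obtain ⟨r, hr, hrt⟩ := RCLike.nonneg_iff_exists_ofReal.1 hγ.trace_nonneg
    simp only [Complex.coe_algebraMap] at hrt
    have hr' : (0 : ℂ) ≤ (r : ℂ)⁻¹ := by
      rw [← Complex.ofReal_inv]; exact_mod_cast inv_nonneg.2 hr
    rw [← hrt] at ht
    refine ⟨r, hr, (r : ℂ)⁻¹ • γ, ⟨hγ.smul hr', ?_⟩, ?_⟩
    · rw [Matrix.trace_smul, ← hrt, smul_eq_mul, inv_mul_cancel₀ ht]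
    · rw [smul_inv_smul₀ ht]
  obtain ⟨r, hr, α', hα', rfl⟩ := normalize hα (fun h => h0 (by simp [h]))
  obtain ⟨s, hs, β', hβ', rfl⟩ := normalize hβ (fun h => h0 (by simp [h]))
  refine ⟨r * s, α', β', mul_nonneg hr hs, hα', hβ', ?_⟩
  rw [Matrix.smul_kronecker, Matrix.kronecker_smul, smul_smul, Complex.ofReal_mul]

theorem exists_sum_of_mem_separableCone {a b : ℕ}
    {M : Matrix (Fin a × Fin b) (Fin a × Fin b) ℂ} (hM : M ∈ separableCone a b) :
    ∃ (N : ℕ) (p : Fin N → ℝ) (α : Fin N → Matrix (Fin a) (Fin a) ℂ)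
      (β : Fin N → Matrix (Fin b) (Fin b) ℂ), (∀ i, 0 ≤ p i) ∧
      (∀ i, IsDensityMatrix (α i)) ∧ (∀ i, IsDensityMatrix (β i)) ∧
      M = ∑ i, (p i : ℂ) • (α i ⊗ₖ β i) := by
  induction hM using AddSubmonoid.closure_induction with
  | mem x hx =>
    obtain ⟨α, β, hα, hβ, rfl⟩ := hx
    by_cases h0 : α ⊗ₖ β = 0
    · exact ⟨0, ![], ![], ![], by simp, by simp, by simp, by simp [h0]⟩
    · obtain ⟨r, α', β', hr, hα', hβ', h⟩ := kronecker_exists_density hα hβ h0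
      exact ⟨1, fun _ => r, fun _ => α', fun _ => β', fun _ => hr, fun _ => hα', fun _ => hβ',
        by simpa using h⟩
  | zero => exact ⟨0, ![], ![], ![], by simp, by simp, by simp, by simp⟩
  | add x y _ _ hx hy =>
    obtain ⟨N, p, α, β, hp, hα, hβ, rfl⟩ := hx
    obtain ⟨N', p', α', β', hp', hα', hβ', rfl⟩ := hy
    refine ⟨N + N', Fin.append p p', Fin.append α α', Fin.append β β', fun i => ?_, fun i => ?_,
      fun i => ?_, ?_⟩
    · refine Fin.addCases (fun i => ?_) (fun i => ?_) i <;> simp [hp, hp']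
    · refine Fin.addCases (fun i => ?_) (fun i => ?_) i <;> simp [hα, hα']
    · refine Fin.addCases (fun i => ?_) (fun i => ?_) i <;> simp [hβ, hβ']
    · simp [Fin.sum_univ_add]

/-- Products of density matrices have trace one, so the weights sum to the trace. Normalisation can
therefore be postponed to this point. -/
theorem isSeparableMatrix_of_mem_separableCone {a b : ℕ}
    {M : Matrix (Fin a × Fin b) (Fin a × Fin b) ℂ} (hM : M ∈ separableCone a b)
    (ht : M.trace = 1) : IsSeparableMatrix M := by
  obtain ⟨N, p, α, β, hp, hα, hβ, rfl⟩ := exists_sum_of_mem_separableCone hM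
  refine ⟨N, p, α, β, hp, ?_, hα, hβ, rfl⟩
  simp only [Matrix.trace_sum, Matrix.trace_smul, Matrix.trace_kronecker, (hα _).2, (hβ _).2,
    mul_one, smul_eq_mul] at ht
  exact_mod_cast ht

/-- The matrix `v vᴴ` of a product vector `v = x ⊗ y` lies in the cone. -/
theorem product_mem_separableCone {a b : ℕ} (x : Fin a → ℂ) (y : Fin b → ℂ) :
    (Matrix.of fun p q => x p.1 * y p.2 * star (x q.1 * y q.2)) ∈ separableCone a b := by
  refine AddSubmonoid.subset_closure ⟨_, _, Matrix.posSemidef_vecMulVec_self_star x,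
    Matrix.posSemidef_vecMulVec_self_star y, ?_⟩
  ext p q
  simp [Matrix.vecMulVec_apply, Matrix.kroneckerMap_apply]
  ring

/-- The Laplacian of the single edge joining `p` and `q`. -/
def edgeLaplacian {a b : ℕ} (p q : Fin a × Fin b) : Matrix (Fin a × Fin b) (Fin a × Fin b) ℂ :=
  Matrix.of fun u v =>
    ((Pi.single p.1 1 : Fin a → ℂ) u.1 * (Pi.single p.2 1 : Fin b → ℂ) u.2 -
      (Pi.single q.1 1 : Fin a → ℂ) u.1 * (Pi.single q.2 1 : Fin b → ℂ) u.2) *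
    ((Pi.single p.1 1 : Fin a → ℂ) v.1 * (Pi.single p.2 1 : Fin b → ℂ) v.2 -
      (Pi.single q.1 1 : Fin a → ℂ) v.1 * (Pi.single q.2 1 : Fin b → ℂ) v.2)

theorem edgeLaplacian_comm {a b : ℕ} (p q : Fin a × Fin b) :
    edgeLaplacian p q = edgeLaplacian q p := by
  ext u v
  simp only [edgeLaplacian, Matrix.of_apply]
  ring

theorem star_single_one {a : ℕ} (i j : Fin a) :
    (starRingEnd ℂ) ((Pi.single i 1 : Fin a → ℂ) j) = (Pi.single i 1 : Fin a → ℂ) j := by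
  by_cases h : j = i <;> simp [h]

theorem edgeLaplacian_mem_separableCone {a b : ℕ} {p q : Fin a × Fin b}
    (h : p.1 = q.1 ∨ p.2 = q.2) : edgeLaplacian p q ∈ separableCone a b := by
  rcases h with h | h
  · convert product_mem_separableCone (Pi.single p.1 1 : Fin a → ℂ)
      ((Pi.single p.2 1 : Fin b → ℂ) - Pi.single q.2 1) using 1
    ext u v
    simp [edgeLaplacian, star_single_one, ← h]
    ring
  · convert product_mem_separableCone ((Pi.single p.1 1 : Fin a → ℂ) - Pi.single q.1 1)
      (Pi.single p.2 1 : Fin b → ℂ) using 1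
    ext u v
    simp [edgeLaplacian, star_single_one, ← h]
    ring

/-- The sum and the difference of the two edge vectors factor as `(e_i - e_k) ⊗ (e_j + e_l)` and
`(e_i + e_k) ⊗ (e_j - e_l)`; the parallelogram identity gives the factor `1 / 2`. -/
theorem crissCross_mem_separableCone {a b : ℕ} (i k : Fin a) (j l : Fin b) :
    edgeLaplacian (i, j) (k, l) + edgeLaplacian (i, l) (k, j) ∈ separableCone a b := by
  have h := smul_mem_separableCone (add_mem
    (product_mem_separableCone ((Pi.single i 1 : Fin a → ℂ) + Pi.single k 1)
      ((Pi.single j 1 : Fin b → ℂ) - Pi.single l 1))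
    (product_mem_separableCone ((Pi.single i 1 : Fin a → ℂ) - Pi.single k 1)
      ((Pi.single j 1 : Fin b → ℂ) + Pi.single l 1))) (r := 1 / 2) (by
    rw [Complex.nonneg_iff]; norm_num)
  convert h using 1
  ext u v
  simp [edgeLaplacian, star_single_one]
  ring

/-- Parseval for the Fourier transform on three points, with `ω ^ 2` in the role of the conjugate of
`ω`. -/
theorem sum_cube_roots {ω : ℂ} (hω : ω ^ 2 + ω + 1 = 0) (x₁ x₂ x₃ y₁ y₂ y₃ : ℂ) :
    (x₁ + x₂ + x₃) * (y₁ + y₂ + y₃) +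
      (x₁ + ω * x₂ + ω ^ 2 * x₃) * (y₁ + ω ^ 2 * y₂ + ω * y₃) +
      (x₁ + ω ^ 2 * x₂ + ω * x₃) * (y₁ + ω * y₂ + ω ^ 2 * y₃) =
    3 * (x₁ * y₁ + x₂ * y₂ + x₃ * y₃) := by
  have h3 : ω ^ 3 = 1 := by linear_combination (ω - 1) * hω
  have h4 : ω ^ 4 = ω := by linear_combination ω * h3
  ring_nf
  simp only [h3, h4]
  have h2 : ω ^ 2 = -ω - 1 := by linear_combination hω
  simp only [h2]
  ring

theorem exists_cube_root : ∃ ω : ℂ, ω ^ 2 + ω + 1 = 0 ∧ star ω = ω ^ 2 := by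
  have h3 : ((Real.sqrt 3 : ℝ) : ℂ) ^ 2 = 3 := by
    rw [← Complex.ofReal_pow, Real.sq_sqrt (by norm_num)]; norm_num
  have hI := Complex.I_sq
  refine ⟨-1 / 2 + Real.sqrt 3 / 2 * Complex.I, ?_, ?_⟩
  · linear_combination (1 / 4 : ℂ) * Complex.I ^ 2 * h3 + (3 / 4 : ℂ) * hI
  · have : star (-1 / 2 + Real.sqrt 3 / 2 * Complex.I : ℂ) =
        -1 / 2 - Real.sqrt 3 / 2 * Complex.I := by
      simp [sub_eq_add_neg]
    rw [this]
    linear_combination (-1 / 4 : ℂ) * Complex.I ^ 2 * h3 - (3 / 4 : ℂ) * hI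

/-- The edges shift the columns cyclically. Hence, for `ζ ^ 3 = 1`, weighting the edge vectors by
`1, ζ, ζ ^ 2` gives the product vector `(e_i - ζ⁻¹ e_k) ⊗ (e_{j₁} + ζ e_{j₂} + ζ ^ 2 e_{j₃})`, where
`ζ⁻¹ = ζ ^ 2`. -/
theorem rowTally_mem_separableCone {a b : ℕ} (i k : Fin a) (j₁ j₂ j₃ : Fin b) :
    edgeLaplacian (i, j₁) (k, j₂) + edgeLaplacian (i, j₂) (k, j₃) +
      edgeLaplacian (i, j₃) (k, j₁) ∈ separableCone a b := by
  obtain ⟨ω, hω, hs⟩ := exists_cube_root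
  let f (ζ : ℂ) : Fin b → ℂ := fun j => (Pi.single j₁ 1 : Fin b → ℂ) j +
    ζ * (Pi.single j₂ 1 : Fin b → ℂ) j + ζ ^ 2 * (Pi.single j₃ 1 : Fin b → ℂ) j
  let g (ζ : ℂ) : Fin a → ℂ := fun l => (Pi.single i 1 : Fin a → ℂ) l -
    ζ ^ 2 * (Pi.single k 1 : Fin a → ℂ) l
  have h := smul_mem_separableCone (add_mem (add_mem (product_mem_separableCone (g 1) (f 1))
    (product_mem_separableCone (g ω) (f ω)))
    (product_mem_separableCone (g (ω ^ 2)) (f (ω ^ 2)))) (r := 1 / 3) (by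
    rw [Complex.nonneg_iff]; norm_num)
  convert h using 1
  have h3 : ω ^ 3 = 1 := by linear_combination (ω - 1) * hω
  have h4 : ω ^ 4 = ω := by linear_combination ω * h3
  have hs' : (starRingEnd ℂ) ω = ω ^ 2 := hs
  have hss : (ω ^ 2) ^ 2 = ω := by rw [← pow_mul]; exact h4
  ext u v
  have key := sum_cube_roots hω
    ((Pi.single i 1 : Fin a → ℂ) u.1 * (Pi.single j₁ 1 : Fin b → ℂ) u.2 -
      (Pi.single k 1 : Fin a → ℂ) u.1 * (Pi.single j₂ 1 : Fin b → ℂ) u.2)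
    ((Pi.single i 1 : Fin a → ℂ) u.1 * (Pi.single j₂ 1 : Fin b → ℂ) u.2 -
      (Pi.single k 1 : Fin a → ℂ) u.1 * (Pi.single j₃ 1 : Fin b → ℂ) u.2)
    ((Pi.single i 1 : Fin a → ℂ) u.1 * (Pi.single j₃ 1 : Fin b → ℂ) u.2 -
      (Pi.single k 1 : Fin a → ℂ) u.1 * (Pi.single j₁ 1 : Fin b → ℂ) u.2)
    ((Pi.single i 1 : Fin a → ℂ) v.1 * (Pi.single j₁ 1 : Fin b → ℂ) v.2 -
      (Pi.single k 1 : Fin a → ℂ) v.1 * (Pi.single j₂ 1 : Fin b → ℂ) v.2)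
    ((Pi.single i 1 : Fin a → ℂ) v.1 * (Pi.single j₂ 1 : Fin b → ℂ) v.2 -
      (Pi.single k 1 : Fin a → ℂ) v.1 * (Pi.single j₃ 1 : Fin b → ℂ) v.2)
    ((Pi.single i 1 : Fin a → ℂ) v.1 * (Pi.single j₃ 1 : Fin b → ℂ) v.2 -
      (Pi.single k 1 : Fin a → ℂ) v.1 * (Pi.single j₁ 1 : Fin b → ℂ) v.2)
  simp only [edgeLaplacian, Matrix.add_apply, Matrix.smul_apply, Matrix.of_apply, smul_eq_mul, f,
    g, star_mul', star_add, star_sub, star_pow, RCLike.star_def, star_one, star_single_one,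
    hs', hss]
  generalize (Pi.single i 1 : Fin a → ℂ) u.1 = A at *
  generalize (Pi.single k 1 : Fin a → ℂ) u.1 = B at *
  generalize (Pi.single i 1 : Fin a → ℂ) v.1 = A' at *
  generalize (Pi.single k 1 : Fin a → ℂ) v.1 = B' at *
  generalize (Pi.single j₁ 1 : Fin b → ℂ) u.2 = X at *
  generalize (Pi.single j₂ 1 : Fin b → ℂ) u.2 = Y at *
  generalize (Pi.single j₃ 1 : Fin b → ℂ) u.2 = Z at *
  generalize (Pi.single j₁ 1 : Fin b → ℂ) v.2 = X' at *
  generalize (Pi.single j₂ 1 : Fin b → ℂ) v.2 = Y' at *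
  generalize (Pi.single j₃ 1 : Fin b → ℂ) v.2 = Z' at *
  -- These identities regroup the product vectors into Fourier combinations of the edge vectors;
  -- `e1` serves `ω` and `e2` its conjugate.
  have e1 : ∀ A B X Y Z : ℂ, (A - ω ^ 2 * B) * (X + ω * Y + ω ^ 2 * Z) =
      (A * X - B * Y) + ω * (A * Y - B * Z) + ω ^ 2 * (A * Z - B * X) := by
    intro A B X Y Z
    linear_combination (-(B * Y) - ω * B * Z) * h3
  have e2 : ∀ A B X Y Z : ℂ, (A - ω * B) * (X + ω ^ 2 * Y + ω * Z) =
      (A * X - B * Y) + ω ^ 2 * (A * Y - B * Z) + ω * (A * Z - B * X) := by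
    intro A B X Y Z
    linear_combination (-(B * Y)) * h3
  rw [e1, e2, e1, e2]
  linear_combination (-1 / 3 : ℂ) * key

theorem swap_mem_separableCone {a b : ℕ} {M : Matrix (Fin a × Fin b) (Fin a × Fin b) ℂ}
    (hM : M ∈ separableCone a b) : M.submatrix Prod.swap Prod.swap ∈ separableCone b a := by
  induction hM using AddSubmonoid.closure_induction with
  | mem x hx =>
    obtain ⟨α, β, hα, hβ, rfl⟩ := hx
    refine AddSubmonoid.subset_closure ⟨β, α, hβ, hα, ?_⟩
    ext p q
    simp [Matrix.kroneckerMap_apply, mul_comm]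
  | zero => exact zero_mem _
  | add x y _ _ hx hy => exact add_mem hx hy

theorem colTally_mem_separableCone {a b : ℕ} (i₁ i₂ i₃ : Fin a) (j l : Fin b) :
    edgeLaplacian (i₁, j) (i₂, l) + edgeLaplacian (i₂, j) (i₃, l) +
      edgeLaplacian (i₃, j) (i₁, l) ∈ separableCone a b := by
  convert swap_mem_separableCone (rowTally_mem_separableCone j l i₁ i₂ i₃) using 1
  ext u v
  simp [edgeLaplacian]
  ring

/-! ### Sufficiency: decomposing the Laplacian of a graph into edge Laplacians. -/

namespace GridGraph

-- The factor 2 appears because ordered pairs meet every edge twice.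
open Classical in
theorem two_smul_lapMatrix {a b : ℕ} (G : GridGraph a b) :
    (2 : ℂ) • G.lapMatrix ℂ = ∑ p, ∑ q, if G.Adj p q then edgeLaplacian p q else 0 := by
  have hsingle : ∀ p u : Fin a × Fin b, (Pi.single p.1 1 : Fin a → ℂ) u.1 *
      (Pi.single p.2 1 : Fin b → ℂ) u.2 = if u = p then 1 else 0 := by
    rintro ⟨i, j⟩ ⟨k, l⟩
    simp only [Pi.single_apply, Prod.mk.injEq]
    by_cases h : k = i <;> by_cases h' : l = j <;> simp [h, h']
  ext u v
  -- The four terms are the two diagonal and the two off-diagonal entries of `(e_p - e_q)(e_p -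
  -- e_q)ᵀ`.
  have h1 : ∀ p q, (if G.Adj p q then edgeLaplacian p q else 0) u v =
      (if u = p then (if u = v then (if G.Adj p q then 1 else 0) else 0) else 0) +
      (if u = q then (if u = v then (if G.Adj p q then 1 else 0) else 0) else 0) -
      (if u = p then (if v = q then (if G.Adj p q then 1 else 0) else 0) else 0) -
      (if v = p then (if u = q then (if G.Adj p q then 1 else 0) else 0) else 0) := by
    intro p q
    by_cases h : G.Adj p q
    · simp only [h, if_true, edgeLaplacian, Matrix.of_apply, hsingle]
      have := h.ne
      split_ifs <;> simp_all
    · simp [h]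
  simp only [Matrix.sum_apply, h1, Finset.sum_sub_distrib, Finset.sum_add_distrib]
  have h2 : ∀ f : Fin a × Fin b → Fin a × Fin b → ℂ, ∀ w,
      ∑ p, ∑ q, (if w = p then f p q else 0) = ∑ q, f w q := by
    intro f w
    rw [Finset.sum_comm]
    simp
  rw [h2, h2, h2, Finset.sum_comm (f := fun p q => if u = q then _ else _), h2]
  simp only [SimpleGraph.lapMatrix, SimpleGraph.degMatrix, Matrix.sub_apply, Matrix.smul_apply,
    Matrix.diagonal_apply, SimpleGraph.adjMatrix_apply, G.degree_eq_sum_if_adj]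
  by_cases h : u = v
  · subst h
    simp [G.adj_comm]
    ring
  · by_cases h' : G.Adj u v <;> simp [h, h', G.adj_comm v u]
    norm_num

theorem trace_density {a b : ℕ} {G : GridGraph a b} (he : G.edgeSet.ncard ≠ 0) :
    (density G).trace = 1 := by
  classical
  have h1 : (G.lapMatrix ℂ).trace = 2 * (G.edgeSet.ncard : ℂ) := by
    simp only [Matrix.trace, Matrix.diag_apply, SimpleGraph.lapMatrix, SimpleGraph.degMatrix,
      Matrix.sub_apply, Matrix.diagonal_apply_eq, SimpleGraph.adjMatrix_apply, G.irrefl, if_false,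
      sub_zero]
    have h2 := G.sum_degrees_eq_twice_card_edges
    rw [← SimpleGraph.coe_edgeFinset, Set.ncard_coe_finset]
    exact_mod_cast h2
  rw [density, Matrix.trace_smul, smul_eq_mul]
  have h2 : (2 * (G.edgeSet.ncard : ℂ)) ≠ 0 := by simpa using he
  convert one_div_mul_cancel h2 using 2

open Classical in
/-- A graph is separable as soon as the Laplacian of its diagonal part is separable up to
normalization. -/
theorem isSeparable_of_diagonalPart {a b : ℕ} {G : GridGraph a b} (he : G.edgeSet.ncard ≠ 0)
    (hD : ∑ p, ∑ q, (if (diagonalPart G).Adj p q then edgeLaplacian p q else 0) ∈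
      separableCone a b) : IsSeparable G := by
  refine isSeparableMatrix_of_mem_separableCone ?_ (trace_density he)
  have h1 : (2 : ℂ) • G.lapMatrix ℂ ∈ separableCone a b := by
    rw [two_smul_lapMatrix]
    have h2 : ∀ p q, (if G.Adj p q then edgeLaplacian p q else 0) =
        (if (diagonalPart G).Adj p q then edgeLaplacian p q else 0) +
        if G.Adj p q ∧ (p.1 = q.1 ∨ p.2 = q.2) then edgeLaplacian p q else 0 := by
      intro p q
      simp only [diagonalPart]
      by_cases h : G.Adj p q <;> by_cases h1 : p.1 = q.1 <;> by_cases h2 : p.2 = q.2 <;>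
        simp [h, h1, h2]
    simp only [h2, Finset.sum_add_distrib]
    refine add_mem hD (sum_mem fun p _ => sum_mem fun q _ => ?_)
    split_ifs with h
    · exact edgeLaplacian_mem_separableCone h.2
    · exact zero_mem _
  have h3 : density G = ((1 / (4 * G.edgeSet.ncard : ℝ) : ℝ) : ℂ) • (2 : ℂ) • G.lapMatrix ℂ := by
    have : (G.edgeSet.ncard : ℂ) ≠ 0 := by exact_mod_cast he
    rw [density, smul_smul]
    congr 1
    push_cast
    field_simp
    norm_num
  rw [h3]
  exact smul_mem_separableCone h1 (by
    have : (0 : ℝ) ≤ 1 / (4 * G.edgeSet.ncard : ℝ) := by positivity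
    exact_mod_cast this)

open Classical in
theorem sum_edgeLaplacian_of_eq {a b : ℕ} {p q : Fin a × Fin b} (h : p ≠ q) :
    ∑ u, ∑ v, (if s(u, v) = s(p, q) then edgeLaplacian u v else 0) =
      (2 : ℂ) • edgeLaplacian p q := by
  have h1 : ∀ u v, (if s(u, v) = s(p, q) then edgeLaplacian u v else 0) =
      (if u = p then (if v = q then edgeLaplacian u v else 0) else 0) +
      (if u = q then (if v = p then edgeLaplacian u v else 0) else 0) := by
    intro u v
    simp only [Sym2.eq_iff]
    by_cases h1 : u = p
    · subst h1; simp [h]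
    · simp [h1, ite_and]
  simp only [h1, Finset.sum_add_distrib]
  have h2 : ∀ (f : Fin a × Fin b → Fin a × Fin b → Matrix (Fin a × Fin b) (Fin a × Fin b) ℂ) w,
      ∑ u, ∑ v, (if u = w then f u v else 0) = ∑ v, f w v := by
    intro f w
    rw [Finset.sum_comm]
    simp
  rw [h2, h2]
  simp [edgeLaplacian_comm q p, two_smul]

theorem IsCrissCross.isSeparable {a b : ℕ} {G : GridGraph a b} (h : IsCrissCross (diagonalPart G))
    (he : G.edgeSet.ncard ≠ 0) : IsSeparable G := by
  classical
  refine isSeparable_of_diagonalPart he ?_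
  obtain ⟨i, k, j, l, hik, hjl, hE⟩ := h
  have hadj : ∀ u v, (if (diagonalPart G).Adj u v then edgeLaplacian u v else 0) =
      (if s(u, v) = s((i, j), (k, l)) then edgeLaplacian u v else 0) +
      (if s(u, v) = s((i, l), (k, j)) then edgeLaplacian u v else 0) := by
    intro u v
    have hne : s((i, j), (k, l)) ≠ s((i, l), (k, j)) := by simp [hik, hjl]
    rw [← SimpleGraph.mem_edgeSet, hE]
    by_cases h1 : s(u, v) = s((i, j), (k, l)) <;> by_cases h2 : s(u, v) = s((i, l), (k, j)) <;>
      grind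
  simp only [hadj, Finset.sum_add_distrib]
  rw [sum_edgeLaplacian_of_eq (by simp [hik]), sum_edgeLaplacian_of_eq (by simp [hik]), ← smul_add]
  exact smul_mem_separableCone (crissCross_mem_separableCone i k j l) zero_le_two

open Classical in
theorem sum_edgeLaplacian_of_edgeSet_eq {a b : ℕ} {D : GridGraph a b}
    {p₁ q₁ p₂ q₂ p₃ q₃ : Fin a × Fin b}
    (hE : D.edgeSet = {s(p₁, q₁), s(p₂, q₂), s(p₃, q₃)}) (h12 : s(p₁, q₁) ≠ s(p₂, q₂))
    (h13 : s(p₁, q₁) ≠ s(p₃, q₃)) (h23 : s(p₂, q₂) ≠ s(p₃, q₃)) :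
    ∑ u, ∑ v, (if D.Adj u v then edgeLaplacian u v else 0) =
      (2 : ℂ) • (edgeLaplacian p₁ q₁ + edgeLaplacian p₂ q₂ + edgeLaplacian p₃ q₃) := by
  have hadj : ∀ u v, (if D.Adj u v then edgeLaplacian u v else 0) =
      (if s(u, v) = s(p₁, q₁) then edgeLaplacian u v else 0) +
      (if s(u, v) = s(p₂, q₂) then edgeLaplacian u v else 0) +
      (if s(u, v) = s(p₃, q₃) then edgeLaplacian u v else 0) := by
    intro u v
    rw [← SimpleGraph.mem_edgeSet, hE]
    by_cases h1 : s(u, v) = s(p₁, q₁)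
    · simp [h1, h12, h13]
    · by_cases h2 : s(u, v) = s(p₂, q₂)
      · simp [h2, h12.symm, h23]
      · simp only [Set.mem_insert_iff, Set.mem_singleton_iff, h1, h2, false_or, if_false, zero_add]
  have hne : ∀ p q, s(p, q) ∈ D.edgeSet → p ≠ q := fun p q h => SimpleGraph.Adj.ne h
  simp only [hadj, Finset.sum_add_distrib]
  rw [sum_edgeLaplacian_of_eq (hne _ _ (by simp [hE])),
    sum_edgeLaplacian_of_eq (hne _ _ (by simp [hE])),
    sum_edgeLaplacian_of_eq (hne _ _ (by simp [hE])), smul_add, smul_add]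

theorem IsRowTally.isSeparable {a b : ℕ} {G : GridGraph a b} (h : IsRowTally (diagonalPart G))
    (he : G.edgeSet.ncard ≠ 0) : IsSeparable G := by
  refine isSeparable_of_diagonalPart he ?_
  obtain ⟨i, k, j₁, j₂, j₃, hik, h12, h13, h23, hE⟩ := h
  rw [sum_edgeLaplacian_of_edgeSet_eq hE (by simp [hik, h12]) (by simp [hik, h13])
    (by simp [hik, h23])]
  exact smul_mem_separableCone (rowTally_mem_separableCone i k j₁ j₂ j₃) zero_le_two

theorem IsColTally.isSeparable {a b : ℕ} {G : GridGraph a b} (h : IsColTally (diagonalPart G))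
    (he : G.edgeSet.ncard ≠ 0) : IsSeparable G := by
  refine isSeparable_of_diagonalPart he ?_
  obtain ⟨i₁, i₂, i₃, j, l, h12, h13, h23, hjl, hE⟩ := h
  rw [sum_edgeLaplacian_of_edgeSet_eq hE (by simp [hjl, h12]) (by simp [hjl, h13])
    (by simp [hjl, h23])]
  exact smul_mem_separableCone (colTally_mem_separableCone i₁ i₂ i₃ j l) zero_le_two

end GridGraph

/-! ### Second-order local isomorphism as partial injections of rows and columns. -/

namespace GridGraph

/-- An injection between subsets of a finite set extends to a permutation. The values of `f'`
outside the image of `S` are placeholders. -/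
theorem exists_perm_extending {c d r : ℕ} (hcr : c ≤ r) (hdr : d ≤ r) (f : Fin c → Fin d)
    (S : Set (Fin c)) (hf : Set.InjOn f S) :
    ∃ π : Equiv.Perm (Fin r), ∀ i ∈ S, π (Fin.castLE hcr i) = Fin.castLE hdr (f i) := by
  classical
  let f' : Fin r → Fin r := fun x => if h : x.1 < c then Fin.castLE hdr (f ⟨x, h⟩) else x
  have hf' : ∀ i : Fin c, f' (Fin.castLE hcr i) = Fin.castLE hdr (f i) := by
    intro i
    simp [f']
  obtain ⟨g, hg⟩ := Set.MapsTo.exists_equiv_extend_of_card_eq (t := (Finset.univ : Finset (Fin r)))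
    (by simp) (s := Fin.castLE hcr '' S) (f := f') (by simp [Set.MapsTo]) (by
      rintro _ ⟨i, hi, rfl⟩ _ ⟨j, hj, rfl⟩ h
      rw [hf', hf'] at h
      rw [hf hi hj (Fin.castLE_injective hdr h)])
  refine ⟨g.trans (Equiv.subtypeUnivEquiv (by simp)), fun i hi => ?_⟩
  rw [← hf']
  exact hg _ ⟨i, hi, rfl⟩

/-- Partial injections on rows and columns that carry the edges of one graph to those of another
give a second order local isomorphism. -/
theorem secondOrderLocallyIsomorphic_of_injOn {a b c d : ℕ} {G : GridGraph a b}
    {H : GridGraph c d} (f : Fin a → Fin c) (g : Fin b → Fin d) (S : Set (Fin a)) (T : Set (Fin b))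
    (hf : Set.InjOn f S) (hg : Set.InjOn g T) (hG : ∀ p q, G.Adj p q → p.1 ∈ S ∧ p.2 ∈ T)
    (hE : H.edgeSet = Sym2.map (Prod.map f g) '' G.edgeSet) :
    SecondOrderLocallyIsomorphic G H := by
  obtain ⟨π, hπ⟩ := exists_perm_extending (le_max_left a c) (le_max_right a c) f S hf
  obtain ⟨σ, hσ⟩ := exists_perm_extending (le_max_left b d) (le_max_right b d) g T hg
  refine ⟨max a c, max b d, _, _, ⟨le_max_left a c, le_max_left b d, rfl⟩,
    ⟨le_max_right a c, le_max_right b d, rfl⟩, π, σ, fun u v => ?_⟩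
  simp only [SimpleGraph.map_adj]
  have hH : ∀ p q, H.Adj p q ↔ ∃ u v, G.Adj u v ∧ Prod.map f g u = p ∧ Prod.map f g v = q := by
    intro p q
    rw [← SimpleGraph.mem_edgeSet, hE]
    constructor
    · rintro ⟨e, he, h⟩
      induction e with | _ u v
      rw [Sym2.map_mk, Sym2.eq_iff] at h
      rcases h with ⟨h1, h2⟩ | ⟨h1, h2⟩
      · exact ⟨u, v, he, h1, h2⟩
      · exact ⟨v, u, SimpleGraph.Adj.symm he, h2, h1⟩
    · rintro ⟨u, v, h, rfl, rfl⟩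
      exact ⟨s(u, v), h, rfl⟩
  have hcast : ∀ p q, G.Adj p q → ((π (Fin.castLE (le_max_left a c) p.1),
      σ (Fin.castLE (le_max_left b d) p.2)) : Fin (max a c) × Fin (max b d)) =
      (Fin.castLE (le_max_right a c) (f p.1), Fin.castLE (le_max_right b d) (g p.2)) := by
    intro p q h
    rw [hπ _ (hG p q h).1, hσ _ (hG p q h).2]
  constructor
  · rintro ⟨p, q, h, rfl, rfl⟩
    refine ⟨Prod.map f g p, Prod.map f g q, (hH _ _).2 ⟨p, q, h, rfl, rfl⟩, ?_, ?_⟩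
    · exact (hcast p q h).symm
    · exact (hcast q p h.symm).symm
  · rintro ⟨p', q', h', h1, h2⟩
    obtain ⟨p, q, h, rfl, rfl⟩ := (hH _ _).1 h'
    refine ⟨p, q, h, ?_, ?_⟩
    · have := (hcast p q h).trans h1
      exact Prod.ext (π.injective (congrArg Prod.fst this)) (σ.injective (congrArg Prod.snd this))
    · have := (hcast q p h.symm).trans h2
      exact Prod.ext (π.injective (congrArg Prod.fst this)) (σ.injective (congrArg Prod.snd this))

/-- A second order local isomorphism restricts to partial injections on the rows and the columns
that meet edges. -/
theorem SecondOrderLocallyIsomorphic.exists_injOn {a b c d : ℕ} {G : GridGraph a b}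
    {H : GridGraph c d} (h : SecondOrderLocallyIsomorphic G H) (hc : 0 < c) (hd : 0 < d) :
    ∃ (f : Fin a → Fin c) (g : Fin b → Fin d),
      Set.InjOn f {i | ∃ p q, G.Adj p q ∧ p.1 = i} ∧ Set.InjOn g {j | ∃ p q, G.Adj p q ∧ p.2 = j} ∧
      H.edgeSet = Sym2.map (Prod.map f g) '' G.edgeSet := by
  obtain ⟨r, s, _, _, ⟨har, hbs, rfl⟩, ⟨hcr, hds, rfl⟩, π, σ, h⟩ := h
  have fwd : ∀ p q, G.Adj p q → ∃ t u, H.Adj t u ∧ π (Fin.castLE har p.1) = Fin.castLE hcr t.1 ∧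
      σ (Fin.castLE hbs p.2) = Fin.castLE hds t.2 ∧
      π (Fin.castLE har q.1) = Fin.castLE hcr u.1 ∧
      σ (Fin.castLE hbs q.2) = Fin.castLE hds u.2 := by
    intro p q hpq
    obtain ⟨t, u, htu, h1, h2⟩ := (SimpleGraph.map_adj _ _ _ _).1
      ((h _ _).1 ((extension_adj har hbs G p q).2 hpq))
    exact ⟨t, u, htu, (congrArg Prod.fst h1).symm, (congrArg Prod.snd h1).symm,
      (congrArg Prod.fst h2).symm, (congrArg Prod.snd h2).symm⟩
  have hf : ∀ i : Fin a, ∃ t : Fin c, (∃ p q, G.Adj p q ∧ p.1 = i) →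
      π (Fin.castLE har i) = Fin.castLE hcr t := by
    intro i
    by_cases hi : ∃ p q, G.Adj p q ∧ p.1 = i
    · obtain ⟨p, q, hpq, rfl⟩ := hi
      obtain ⟨t, _, _, ht, _⟩ := fwd p q hpq
      exact ⟨t.1, fun _ => ht⟩
    -- Rows that meet no edge may leave the grid of `H` under `π`; any value will do there, which is
    -- why `c` must be positive.
    · exact ⟨⟨0, hc⟩, fun h => absurd h hi⟩
  have hg : ∀ j : Fin b, ∃ t : Fin d, (∃ p q, G.Adj p q ∧ p.2 = j) →
      σ (Fin.castLE hbs j) = Fin.castLE hds t := by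
    intro i
    by_cases hi : ∃ p q, G.Adj p q ∧ p.2 = i
    · obtain ⟨p, q, hpq, rfl⟩ := hi
      obtain ⟨t, _, _, _, ht, _⟩ := fwd p q hpq
      exact ⟨t.2, fun _ => ht⟩
    · exact ⟨⟨0, hd⟩, fun h => absurd h hi⟩
  choose f hf using hf
  choose g hg using hg
  have hfg : ∀ p q, G.Adj p q →
      ((π (Fin.castLE har p.1), σ (Fin.castLE hbs p.2)) : Fin r × Fin s) =
        (Fin.castLE hcr (Prod.map f g p).1, Fin.castLE hds (Prod.map f g p).2) := by
    intro p q hpq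
    rw [hf _ ⟨p, q, hpq, rfl⟩, hg _ ⟨p, q, hpq, rfl⟩]
    rfl
  have hmap : ∀ p q, G.Adj p q → H.Adj (Prod.map f g p) (Prod.map f g q) := by
    intro p q hpq
    have h1 := (h _ _).1 ((extension_adj har hbs G p q).2 hpq)
    rw [hfg p q hpq, hfg q p hpq.symm] at h1
    exact (extension_adj hcr hds H _ _).1 h1
  refine ⟨f, g, ?_, ?_, ?_⟩
  · intro i hi j hj hij
    have := (hf i hi).trans ((congrArg _ hij).trans (hf j hj).symm)
    exact Fin.castLE_injective har (π.injective this)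
  · intro i hi j hj hij
    have := (hg i hi).trans ((congrArg _ hij).trans (hg j hj).symm)
    exact Fin.castLE_injective hbs (σ.injective this)
  · ext e
    induction e with | _ t u
    constructor
    · intro htu
      -- Pulled back by `π` and `σ`, an edge of `H` becomes an edge of the extension of `G`, hence
      -- comes from `G`.
      have h1 := (h (π.symm (Fin.castLE hcr t.1), σ.symm (Fin.castLE hds t.2))
        (π.symm (Fin.castLE hcr u.1), σ.symm (Fin.castLE hds u.2))).2
        (by simpa using (extension_adj hcr hds H t u).2 htu)
      obtain ⟨p, q, hpq, h2, h3⟩ := (SimpleGraph.map_adj _ _ _ _).1 h1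
      have key : ∀ p q (t : Fin c × Fin d), G.Adj p q →
          (Fin.castLEEmb har).prodMap (Fin.castLEEmb hbs) p =
            (π.symm (Fin.castLE hcr t.1), σ.symm (Fin.castLE hds t.2)) → Prod.map f g p = t := by
        intro p q t hpq h
        have h4 := hfg p q hpq
        have h5 := (Equiv.eq_symm_apply π).1 (congrArg Prod.fst h)
        have h6 := (Equiv.eq_symm_apply σ).1 (congrArg Prod.snd h)
        exact Prod.ext (Fin.castLE_injective hcr ((congrArg Prod.fst h4).symm.trans h5))
          (Fin.castLE_injective hds ((congrArg Prod.snd h4).symm.trans h6))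
      refine ⟨s(p, q), hpq, ?_⟩
      rw [Sym2.map_mk, key p q t hpq h2, key q p u hpq.symm h3]
    · rintro ⟨e, he, h1⟩
      induction e with | _ p q
      rw [← h1]
      exact hmap p q he

theorem crissCross_edgeSet : crissCross.edgeSet = {s((0, 0), (1, 1)), s((0, 1), (1, 0))} := by
  rw [crissCross, SimpleGraph.edgeSet_fromEdgeSet, sdiff_eq_left, Set.disjoint_left]
  rintro e (rfl | rfl) <;> simp

theorem tally_edgeSet :
    tally.edgeSet = {s((0, 0), (1, 1)), s((0, 1), (1, 2)), s((1, 0), (0, 2))} := by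
  rw [tally, SimpleGraph.edgeSet_fromEdgeSet, sdiff_eq_left, Set.disjoint_left]
  rintro e (rfl | rfl | rfl) <;> simp

theorem rotate_edgeSet {a b : ℕ} (G : GridGraph a b) :
    (rotate G).edgeSet = Sym2.map (fun p => (p.2, Fin.rev p.1)) '' G.edgeSet := by
  rw [rotate, SimpleGraph.edgeSet_map]
  rfl

theorem isCrissCross_crissCross : IsCrissCross crissCross :=
  ⟨0, 1, 0, 1, by decide, by decide, crissCross_edgeSet⟩

theorem isRowTally_tally : IsRowTally tally :=
  ⟨0, 1, 0, 1, 2, by decide, by decide, by decide, by decide, by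
    rw [tally_edgeSet, Sym2.eq_swap (a := ((1 : Fin 3), (0 : Fin 3)))]⟩

theorem IsRowTally.rotate {a b : ℕ} {G : GridGraph a b} (h : IsRowTally G) :
    IsColTally (rotate G) := by
  obtain ⟨i, k, j₁, j₂, j₃, hik, h12, h13, h23, hE⟩ := h
  refine ⟨j₁, j₂, j₃, i.rev, k.rev, h12, h13, h23, fun h => hik (Fin.rev_injective h), ?_⟩
  rw [rotate_edgeSet, hE]
  simp only [Set.image_insert_eq, Set.image_singleton, Sym2.map_mk]

theorem IsColTally.rotate {a b : ℕ} {G : GridGraph a b} (h : IsColTally G) :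
    IsRowTally (rotate G) := by
  obtain ⟨i₁, i₂, i₃, j, l, h12, h13, h23, hjl, hE⟩ := h
  refine ⟨j, l, i₁.rev, i₂.rev, i₃.rev, hjl, fun h => h12 (Fin.rev_injective h),
    fun h => h13 (Fin.rev_injective h), fun h => h23 (Fin.rev_injective h), ?_⟩
  rw [rotate_edgeSet, hE]
  simp only [Set.image_insert_eq, Set.image_singleton, Sym2.map_mk]

/-- A quarter turn interchanges rows and columns, and reversing labels preserves both shapes, so the
rotations alternate between the two kinds. -/
theorem isTally_rotate_iterate_tally (k : ℕ) :
    IsRowTally (GridGraph.rotate^[k] tally) ∨ IsColTally (GridGraph.rotate^[k] tally) := by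
  induction k with
  | zero => exact Or.inl isRowTally_tally
  | succ k ih =>
    rw [Function.iterate_succ_apply']
    exact ih.symm.imp IsColTally.rotate IsRowTally.rotate

theorem isCrissCross_iff_secondOrderLocallyIsomorphic {a b c d : ℕ} {G : GridGraph a b}
    {H : GridGraph c d} (hG : IsCrissCross G) (hc : 0 < c) (hd : 0 < d) :
    IsCrissCross H ↔ SecondOrderLocallyIsomorphic G H := by
  obtain ⟨i, k, j, l, hik, hjl, hE⟩ := hG
  have hadj : ∀ p q, s(p, q) ∈ G.edgeSet → G.Adj p q := fun _ _ h => h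
  have h1 := hadj (i, j) (k, l) (by simp [hE])
  constructor
  · rintro ⟨i', k', j', l', hik', hjl', hE'⟩
    -- Injectivity is needed only on the rows and columns of the shape, so the final `else` value
    -- may be reused elsewhere.
    refine secondOrderLocallyIsomorphic_of_injOn (fun x => if x = i then i' else k')
      (fun x => if x = j then j' else l') {i, k} {j, l} ?_ ?_ ?_ ?_
    · rintro x (rfl | rfl) y (rfl | rfl) <;> simp [hik.symm, hik', hik'.symm]
    · rintro x (rfl | rfl) y (rfl | rfl) <;> simp [hjl.symm, hjl', hjl'.symm]
    · intro p q hpq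
      rw [← SimpleGraph.mem_edgeSet, hE] at hpq
      simp only [Set.mem_insert_iff, Set.mem_singleton_iff, Sym2.eq_iff] at hpq
      rcases hpq with (⟨rfl, rfl⟩ | ⟨rfl, rfl⟩) | (⟨rfl, rfl⟩ | ⟨rfl, rfl⟩) <;> simp
    · rw [hE, hE']
      simp [Set.image_insert_eq, hik.symm, hjl.symm]
  · intro h
    obtain ⟨f, g, hf, hg, hH⟩ := h.exists_injOn hc hd
    refine ⟨f i, f k, g j, g l, fun h => hik (hf ⟨_, _, h1, rfl⟩ ⟨_, _, h1.symm, rfl⟩ h),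
      fun h => hjl (hg ⟨_, _, h1, rfl⟩ ⟨_, _, h1.symm, rfl⟩ h), ?_⟩
    rw [hH, hE]
    simp [Set.image_insert_eq]

theorem IsRowTally.of_secondOrderLocallyIsomorphic {a b c d : ℕ} {G : GridGraph a b}
    {H : GridGraph c d} (hG : IsRowTally G) (hc : 0 < c) (hd : 0 < d)
    (h : SecondOrderLocallyIsomorphic G H) : IsRowTally H := by
  obtain ⟨i, k, j₁, j₂, j₃, hik, h12, h13, h23, hE⟩ := hG
  have hadj : ∀ p q, s(p, q) ∈ G.edgeSet → G.Adj p q := fun _ _ h => h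
  have e1 := hadj (i, j₁) (k, j₂) (by simp [hE])
  have e2 := hadj (i, j₂) (k, j₃) (by simp [hE])
  obtain ⟨f, g, hf, hg, hH⟩ := h.exists_injOn hc hd
  refine ⟨f i, f k, g j₁, g j₂, g j₃, fun h => hik (hf ⟨_, _, e1, rfl⟩ ⟨_, _, e1.symm, rfl⟩ h),
    fun h => h12 (hg ⟨_, _, e1, rfl⟩ ⟨_, _, e1.symm, rfl⟩ h),
    fun h => h13 (hg ⟨_, _, e1, rfl⟩ ⟨_, _, e2.symm, rfl⟩ h),
    fun h => h23 (hg ⟨_, _, e2, rfl⟩ ⟨_, _, e2.symm, rfl⟩ h), ?_⟩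
  rw [hH, hE]
  simp [Set.image_insert_eq]

theorem IsColTally.of_secondOrderLocallyIsomorphic {a b c d : ℕ} {G : GridGraph a b}
    {H : GridGraph c d} (hG : IsColTally G) (hc : 0 < c) (hd : 0 < d)
    (h : SecondOrderLocallyIsomorphic G H) : IsColTally H := by
  obtain ⟨i₁, i₂, i₃, j, l, h12, h13, h23, hjl, hE⟩ := hG
  have hadj : ∀ p q, s(p, q) ∈ G.edgeSet → G.Adj p q := fun _ _ h => h
  have e1 := hadj (i₁, j) (i₂, l) (by simp [hE])
  have e2 := hadj (i₂, j) (i₃, l) (by simp [hE])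
  obtain ⟨f, g, hf, hg, hH⟩ := h.exists_injOn hc hd
  refine ⟨f i₁, f i₂, f i₃, g j, g l,
    fun h => h12 (hf ⟨_, _, e1, rfl⟩ ⟨_, _, e1.symm, rfl⟩ h),
    fun h => h13 (hf ⟨_, _, e1, rfl⟩ ⟨_, _, e2.symm, rfl⟩ h),
    fun h => h23 (hf ⟨_, _, e2, rfl⟩ ⟨_, _, e2.symm, rfl⟩ h),
    fun h => hjl (hg ⟨_, _, e1, rfl⟩ ⟨_, _, e1.symm, rfl⟩ h), ?_⟩
  rw [hH, hE]
  simp [Set.image_insert_eq]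

theorem IsRowTally.secondOrderLocallyIsomorphic {a b c d : ℕ} {G : GridGraph a b}
    {H : GridGraph c d} (hG : IsRowTally G) (hH : IsRowTally H) :
    SecondOrderLocallyIsomorphic G H := by
  obtain ⟨i, k, j₁, j₂, j₃, hik, h12, h13, h23, hE⟩ := hG
  obtain ⟨i', k', j₁', j₂', j₃', hik', h12', h13', h23', hE'⟩ := hH
  refine secondOrderLocallyIsomorphic_of_injOn (fun x => if x = i then i' else k')
    (fun x => if x = j₁ then j₁' else if x = j₂ then j₂' else j₃') {i, k} {j₁, j₂, j₃} ?_ ?_ ?_ ?_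
  · rintro x (rfl | rfl) y (rfl | rfl) <;> simp [hik.symm, hik', hik'.symm]
  · rintro x (rfl | rfl | rfl) y (rfl | rfl | rfl) <;>
      simp [h12.symm, h13.symm, h23.symm, h12', h13', h23', h12'.symm, h13'.symm, h23'.symm]
  · intro p q hpq
    rw [← SimpleGraph.mem_edgeSet, hE] at hpq
    simp only [Set.mem_insert_iff, Set.mem_singleton_iff, Sym2.eq_iff] at hpq
    rcases hpq with (⟨rfl, rfl⟩ | ⟨rfl, rfl⟩) | (⟨rfl, rfl⟩ | ⟨rfl, rfl⟩) |
      (⟨rfl, rfl⟩ | ⟨rfl, rfl⟩) <;> simp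
  · rw [hE, hE']
    simp [Set.image_insert_eq, hik.symm, h12.symm, h13.symm, h23.symm]

theorem IsColTally.secondOrderLocallyIsomorphic {a b c d : ℕ} {G : GridGraph a b}
    {H : GridGraph c d} (hG : IsColTally G) (hH : IsColTally H) :
    SecondOrderLocallyIsomorphic G H := by
  obtain ⟨i₁, i₂, i₃, j, l, h12, h13, h23, hjl, hE⟩ := hG
  obtain ⟨i₁', i₂', i₃', j', l', h12', h13', h23', hjl', hE'⟩ := hH
  refine secondOrderLocallyIsomorphic_of_injOn
    (fun x => if x = i₁ then i₁' else if x = i₂ then i₂' else i₃')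
    (fun x => if x = j then j' else l') {i₁, i₂, i₃} {j, l} ?_ ?_ ?_ ?_
  · rintro x (rfl | rfl | rfl) y (rfl | rfl | rfl) <;>
      simp [h12.symm, h13.symm, h23.symm, h12', h13', h23', h12'.symm, h13'.symm, h23'.symm]
  · rintro x (rfl | rfl) y (rfl | rfl) <;> simp [hjl.symm, hjl', hjl'.symm]
  · intro p q hpq
    rw [← SimpleGraph.mem_edgeSet, hE] at hpq
    simp only [Set.mem_insert_iff, Set.mem_singleton_iff, Sym2.eq_iff] at hpq
    rcases hpq with (⟨rfl, rfl⟩ | ⟨rfl, rfl⟩) | (⟨rfl, rfl⟩ | ⟨rfl, rfl⟩) |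
      (⟨rfl, rfl⟩ | ⟨rfl, rfl⟩) <;> simp
  · rw [hE, hE']
    simp [Set.image_insert_eq, hjl.symm, h12.symm, h13.symm, h23.symm]

end GridGraph

/-! ### Assembling the two criteria. -/

theorem mainTheorem7 (m n : ℕ) (hm : 2 ≤ m) (hn : 2 ≤ n) (G : GridGraph m n) :
    ((GridGraph.diagonalPart G).edgeSet.ncard = 2 →
      (GridGraph.IsSeparable G ↔
        GridGraph.SecondOrderLocallyIsomorphic GridGraph.crissCross
          (GridGraph.diagonalPart G))) ∧
    ((GridGraph.diagonalPart G).edgeSet.ncard = 3 →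
      (GridGraph.IsSeparable G ↔
        ∃ k : ℕ, GridGraph.SecondOrderLocallyIsomorphic (GridGraph.rotate^[k] GridGraph.tally)
          (GridGraph.diagonalPart G))) := by
  have hm' : 0 < m := by omega
  have hn' : 0 < n := by omega
  constructor
  · intro h
    have he := GridGraph.diagonalPart_edgeSet_ncard_ne_zero (G := G) (by omega)
    rw [← GridGraph.isCrissCross_iff_secondOrderLocallyIsomorphic
      GridGraph.isCrissCross_crissCross hm' hn']
    exact ⟨fun hs => hs.isCrissCross h, fun hc => hc.isSeparable he⟩
  · intro h
    have he := GridGraph.diagonalPart_edgeSet_ncard_ne_zero (G := G) (by omega)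
    constructor
    · intro hs
      rcases hs.isTally h with hr | hc
      -- No turn suffices for a row tally, and one quarter turn for a column tally.
      · exact ⟨0, GridGraph.isRowTally_tally.secondOrderLocallyIsomorphic hr⟩
      · exact ⟨1, GridGraph.isRowTally_tally.rotate.secondOrderLocallyIsomorphic hc⟩
    · rintro ⟨k, hk⟩
      rcases GridGraph.isTally_rotate_iterate_tally k with hr | hc
      · exact (hr.of_secondOrderLocallyIsomorphic hm' hn' hk).isSeparable he
      · exact (hc.of_secondOrderLocallyIsomorphic hm' hn' hk).isSeparable he
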